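/- Write $\log(x)=\ln(\max(x,e))$ for the truncated logarithm and $a\wedge b$ for the minimum. Let $\mathcal F$ be a class of functions $\mathcal X\to\{1,-1\}$ of finite VC dimension $d\ge 1$ (the largest size of a finite set all of whose labellings are realized by $\mathcal F$). Let $\mathbf s\in\mathbb N\cup\{\infty\}$ be its star number: the supremum of the integers $k$ for which there are distinct $x_1,\dots,x_k\in\mathcal X$ and $f_0,f_1,\dots,f_k\in\mathcal F$ such that for every $i$ the functions $f_0$ and $f_i$ disagree at $x_i$ and agree at all $x_j$, $j\ne i$. For points $x_1,\dots,x_n\in\mathcal X$ (not necessarily distinct) let $\rho_H(f,g)=|\{i\le n: f(x_i)\ne g(x_i)\}|$; for $f\in\mathcal F$ let $\mathcal B_H(f,r,\{x_1,\dots,x_n\})=\{g\in\mathcal F:\rho_H(f,g)\le r\}$, and let $\mathcal M_1(\mathcal H,\varepsilon)$ be the largest size of a subset of $\mathcal H$ whose elements are pairwise at distance $\rho_H>\varepsilon$. For $h\in(0,1]$ put \[ \mathcal M_1^{\mathrm{loc}}(\mathcal F,\gamma,n,h)=\max_{x_1,\dots,x_n\in\mathcal X}\ \max_{f\in\mathcal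 F}\ \max_{\varepsilon\ge\gamma}\ \mathcal M_1\bigl(\mathcal B_H(f,\varepsilon/h,\{x_1,\dots,x_n\}),\varepsilon/2\bigr), \] \[ \gamma^{\mathrm{loc}}_{h,h}(n)=\max\{\gamma\in\mathbb N:\ h\gamma\le\log\mathcal M_1^{\mathrm{loc}}(\mathcal F,\gamma,n,h)\}. \] There are universal constants $c,C>0$ such that for every $\mathcal X$, every such $\mathcal F$, every $n\in\mathbb N$ and every $h\in(0,1]$, \[ \gamma^{\mathrm{loc}}_{h,h}(n)\ \le\ C\left(\frac{d\log\left(\frac{nh^2}{d}\wedge\mathbf s\right)}{h}+\frac{d\log\left(\frac1h\right)}{h}\right), \] and, if moreover $n\ge d$, \[ c\left(\frac{d+\log\left(nh^2\wedge\mathbf s\right)}{h}\wedge\sqrt{dn}\right)\ \le\ \gamma^{\mathrm{loc}}_{h,h}(n). \] -/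

import Mathlib

open scoped NNReal ENNReal

noncomputable section

/-- The truncated logarithm `ln (max x e)`. -/
def truncLog (x : ℝ) : ℝ := Real.log (max x (Real.exp 1))

section Classes

variable {X : Type*}

/-- The finite set `S` is shattered by the class `F` of binary classifiers: every labelling of `S`
is realized by some classifier in `F`. -/
def Shattered (F : Set (X → Bool)) (S : Finset X) : Prop :=
  ∀ b : S → Bool, ∃ f ∈ F, ∀ x : S, f x = b x

/-- The VC dimension: the largest size of a shattered set (`⊤` if there is no largest one). -/
def vcDim (F : Set (X → Bool)) : ℕ∞ :=
  ⨆ (S : Finset X) (_ : Shattered F S), (S.card : ℕ∞)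

/-- The region of disagreement of a set of classifiers. -/
def disagreement (B : Set (X → Bool)) : Set X := {x | ∃ f ∈ B, ∃ g ∈ B, f x ≠ g x}

/-- There are `k` distinct points and classifiers `f₀, f₁, …, f_k` in `F` such that, among these
points, `f₀` and `f_i` disagree exactly at the `i`-th one. -/
def HasStar (F : Set (X → Bool)) (k : ℕ) : Prop :=
  ∃ x : Fin k → X, Function.Injective x ∧
    ∃ f₀ ∈ F, ∃ f : Fin k → X → Bool, (∀ i, f i ∈ F) ∧
      ∀ i, disagreement {f₀, f i} ∩ Set.range x = {x i}

/-- The star number: the largest size of a star (`⊤` if there is no largest one). -/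
def starNumber (F : Set (X → Bool)) : ℕ∞ := ⨆ (k : ℕ) (_ : HasStar F k), (k : ℕ∞)

/-- The minimum of a nonnegative real number and a possibly infinite natural number. -/
def minExt (a : ℝ) (s : ℕ∞) : ℝ := (min (ENNReal.ofReal a) (s : ℝ≥0∞)).toReal

/-- The projection of a classifier on the points `x₁, …, xₙ` (repetitions allowed), as a point of
the Hamming cube. -/
def project {n : ℕ} (x : Fin n → X) (f : X → Bool) : Hamming (fun _ : Fin n => Bool) :=
  Hamming.toHamming fun i => f (x i)

/-- The empirical Hamming ball of radius `r` around `f` in the class `F`. -/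
def hammingBall (F : Set (X → Bool)) {n : ℕ} (x : Fin n → X) (f : X → Bool) (r : ℝ) :
    Set (X → Bool) :=
  {g ∈ F | (hammingDist (fun i => f (x i)) (fun i => g (x i)) : ℝ) ≤ r}

/-- The worst-case local empirical packing number: the supremum over all `x₁, …, xₙ`, all `f ∈ F`
and all radii `ε ≥ γ` of the `ε / 2`-packing number of the ball of radius `ε / h` around `f`. -/
def localPackingNumber (F : Set (X → Bool)) (γ : ℝ≥0) (n : ℕ) (h : ℝ) : ℕ∞ :=
  ⨆ (x : Fin n → X) (f ∈ F) (ε : ℝ≥0) (_ : γ ≤ ε),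
    Metric.packingNumber (ε / 2) (project x '' hammingBall F x f (ε / h))

/-- The set of natural numbers whose maximum is the fixed point of the local entropy. -/
def fixedPointSet (F : Set (X → Bool)) (h h' : ℝ) (n : ℕ) : Set ℕ :=
  {γ : ℕ | h * γ ≤ truncLog ((localPackingNumber F γ n h').toNat : ℝ)}

/-- The fixed point of the local empirical entropy. -/
def localFixedPoint (F : Set (X → Bool)) (h h' : ℝ) (n : ℕ) : ℕ := sSup (fixedPointSet F h h' n)

/-- The local packing number is finite. -/
theorem localPackingNumber_le (F : Set (X → Bool)) (γ : ℝ≥0) (n : ℕ) (h : ℝ) :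
    localPackingNumber F γ n h ≤ (2 ^ n : ℕ) := by
  refine iSup_le fun x => iSup_le fun f => iSup_le fun _ => iSup_le fun ε => iSup_le fun _ => ?_
  refine (Metric.packingNumber_le_encard_self _).trans ?_
  refine (Set.encard_le_encard (Set.subset_univ _)).trans ?_
  have : ENat.card (Hamming (fun _ : Fin n => Bool)) = (2 ^ n : ℕ) := by
    have e : Hamming (fun _ : Fin n => Bool) ≃ (Fin n → Bool) := Hamming.ofHamming
    rw [ENat.card_congr e, ENat.card_eq_coe_fintype_card]
    simp
  rw [Set.encard_univ, this]

/-- For `h > 0` the maximum defining the fixed point exists and is attained, for every class. -/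
theorem localFixedPoint_isGreatest (F : Set (X → Bool)) {h : ℝ} (hh : 0 < h) (h' : ℝ) (n : ℕ) :
    IsGreatest (fixedPointSet F h h' n) (localFixedPoint F h h' n) := by
  have hne : (fixedPointSet F h h' n).Nonempty := by
    refine ⟨0, ?_⟩
    simp only [fixedPointSet, truncLog, Set.mem_ofPred_eq, Nat.cast_zero, mul_zero]
    exact Real.log_nonneg (le_max_of_le_right (Real.one_le_exp zero_le_one))
  have hb : BddAbove (fixedPointSet F h h' n) := by
    refine ⟨⌊truncLog (2 ^ n : ℕ) / h⌋₊, fun γ hγ => Nat.le_floor ?_⟩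
    rw [le_div_iff₀ hh, mul_comm]
    refine le_trans hγ ?_
    refine Real.log_le_log (lt_max_of_lt_right (Real.exp_pos 1)) (max_le_max ?_ le_rfl)
    exact_mod_cast ENat.toNat_le_of_le_natCast (localPackingNumber_le F γ n h')
  exact ⟨Nat.sSup_mem hne hb, fun _ hx => le_csSup hb hx⟩

end Classes

end

noncomputable section

variable {X : Type*}

/-! ### Elementary facts on shattering, stars and the truncated minimum -/

/-! Upper bound. Let `Q` be an `ε/2`-separated set inside a ball of radius `ε/h` around `f`, and let
`D` be the set of indices where some member of `Q` differs from `f`. All distances within `Q` are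
computed on `D`, so sampling coordinates from `D` and applying Sauer–Shelah gives `log #Q ≲ d
log(#D/ε)` (`log_card_le_of_separated`). Trivially `#D ≤ n`, while a minimal cover of `D` by
disagreement sets is a star, so `#D ≤ s ε/h` (`card_disagreement_le`). Unless `hγ ≤ d`, every `ε ≥
γ` exceeds `d/h`, and hence `#D/ε ≤ min(nh²/d, s)/h`; the last `1/h` yields the term `d log(1/h)`.

Lower bound. It suffices to exhibit one large separated family in a ball. A family living on a few
points is scaled up by repeating each point `k` times, the leftover indices going to a point where
the family is constant (`le_localFixedPoint_of_separated`). A Varshamov–Gilbert code on a shattered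
set gives `min(d/h, √(dn))`. A star of about `√(nh² ∧ s)` points, each repeated, gives `log(nh² ∧
s)/h`; the square root costs only a constant inside the logarithm and leaves room for enough
repetitions. -/

theorem card_le_of_shattered {F : Set (X → Bool)} {d : ℕ} (hd : vcDim F ≤ d) {S : Finset X}
    (hS : Shattered F S) : S.card ≤ d := by
  have h : (S.card : ℕ∞) ≤ vcDim F := le_iSup₂_of_le S hS le_rfl
  exact_mod_cast h.trans hd

theorem exists_shattered_of_le_vcDim {F : Set (X → Bool)} {d : ℕ} (hd1 : 1 ≤ d)
    (hd : (d : ℕ∞) ≤ vcDim F) : ∃ S : Finset X, Shattered F S ∧ d ≤ S.card := by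
  by_contra! hcon
  have h : vcDim F ≤ ((d - 1 : ℕ) : ℕ∞) := by
    refine iSup₂_le fun S hS => ?_
    have := hcon S hS
    exact_mod_cast (by omega : S.card ≤ d - 1)
  have h2 : d ≤ d - 1 := by exact_mod_cast hd.trans h
  omega

/-- A class obtained by pulling back along a map has no larger VC dimension. -/
theorem vcDim_image_comp_le {ι : Type*} (F : Set (X → Bool)) (y : ι → X) :
    vcDim ((fun f => f ∘ y) '' F) ≤ vcDim F := by
  classical
  refine iSup₂_le fun S hS => ?_
  -- Two indices carrying the same point always receive the same label, so they cannot both belong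
  -- to a shattered set.
  have hinj : Set.InjOn y S := by
    intro a ha b hb hab
    by_contra hne
    obtain ⟨g, ⟨f, -, rfl⟩, hg⟩ := hS fun s => decide (s.1 = a)
    have h1 := hg ⟨a, ha⟩
    have h2 := hg ⟨b, hb⟩
    simp only [Function.comp_apply] at h1 h2
    rw [hab, h2] at h1
    simp [Ne.symm hne] at h1
  have hsh : Shattered F (S.image y) := by
    intro b
    obtain ⟨g, ⟨f, hf, rfl⟩, hg⟩ :=
      hS fun s => b ⟨y s, Finset.mem_image_of_mem y s.2⟩
    refine ⟨f, hf, ?_⟩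
    rintro ⟨z, hz⟩
    obtain ⟨s, hs, rfl⟩ := Finset.mem_image.1 hz
    exact hg ⟨s, hs⟩
  rw [← Finset.card_image_of_injOn hinj]
  exact le_iSup₂_of_le (f := fun (S : Finset X) (_ : Shattered F S) => (S.card : ℕ∞)) _ hsh le_rfl

/-- Injectivity of `x` is forced by the disagreement pattern and can be dropped. Stars can then be
pushed forward along index maps that repeat points. -/
theorem hasStar_iff {F : Set (X → Bool)} {k : ℕ} :
    HasStar F k ↔ ∃ x : Fin k → X, ∃ f₀ ∈ F, ∃ f : Fin k → X → Bool, (∀ i, f i ∈ F) ∧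
      ∀ i j, f₀ (x j) ≠ f i (x j) ↔ i = j := by
  constructor
  · rintro ⟨x, hx, f₀, hf₀, f, hf, hstar⟩
    refine ⟨x, f₀, hf₀, f, hf, fun i j => ?_⟩
    have h := Set.ext_iff.1 (hstar i) (x j)
    simp only [Set.mem_inter_iff, Set.mem_range_self, and_true, Set.mem_singleton_iff] at h
    rw [eq_comm, ← hx.eq_iff, ← h]
    simp [disagreement, eq_comm]
  · rintro ⟨x, f₀, hf₀, f, hf, hstar⟩
    refine ⟨x, fun i j hij => ?_, f₀, hf₀, f, hf, fun i => ?_⟩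
    · have h := (hstar i i).2 rfl
      rw [hij] at h
      exact (hstar i j).1 h
    · ext z
      constructor
      · rintro ⟨hz, j, rfl⟩
        have h : f₀ (x j) ≠ f i (x j) := by
          simpa [disagreement, eq_comm] using hz
        rw [(hstar i j).1 h]; rfl
      · rintro rfl
        exact ⟨⟨f₀, by simp, f i, by simp, (hstar i i).2 rfl⟩, i, rfl⟩

theorem HasStar.mono {F : Set (X → Bool)} {k m : ℕ} (h : HasStar F k) (hm : m ≤ k) :
    HasStar F m := by
  rw [hasStar_iff] at h ⊢
  obtain ⟨x, f₀, hf₀, f, hf, hstar⟩ := h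
  refine ⟨x ∘ Fin.castLE hm, f₀, hf₀, f ∘ Fin.castLE hm, fun i => hf _, fun i j => ?_⟩
  simpa using hstar (Fin.castLE hm i) (Fin.castLE hm j)

theorem HasStar.of_comp {ι : Type*} {F : Set (X → Bool)} {y : ι → X} {k : ℕ}
    (h : HasStar ((fun f => f ∘ y) '' F) k) : HasStar F k := by
  rw [hasStar_iff] at h ⊢
  obtain ⟨x, _, ⟨f₀, hf₀, rfl⟩, f, hf, hstar⟩ := h
  choose g hg hgf using hf
  refine ⟨y ∘ x, f₀, hf₀, g, hg, fun i j => ?_⟩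
  rw [← hstar i j, ← hgf i]
  rfl

theorem hasStar_of_le_starNumber {F : Set (X → Bool)} {m : ℕ} (hm : 1 ≤ m)
    (h : (m : ℕ∞) ≤ starNumber F) : HasStar F m := by
  by_contra hcon
  have h' : starNumber F ≤ ((m - 1 : ℕ) : ℕ∞) := by
    refine iSup₂_le fun k hk => ?_
    have : k < m := by
      by_contra! hle
      exact hcon (hk.mono hle)
    exact_mod_cast (by omega : k ≤ m - 1)
  have h2 : m ≤ m - 1 := by exact_mod_cast h.trans h'
  omega

theorem minExt_le_left {a : ℝ} (ha : 0 ≤ a) (s : ℕ∞) : minExt a s ≤ a := by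
  calc minExt a s ≤ (ENNReal.ofReal a).toReal :=
        ENNReal.toReal_mono ENNReal.ofReal_ne_top (min_le_left _ _)
    _ = a := ENNReal.toReal_ofReal ha

theorem minExt_le_right (a : ℝ) (k : ℕ) : minExt a k ≤ k := by
  calc minExt a k ≤ (((k : ℕ∞) : ℝ≥0∞)).toReal :=
        ENNReal.toReal_mono (by simp) (min_le_right _ _)
    _ = k := by simp

theorem minExt_eq_or {a : ℝ} (ha : 0 ≤ a) (s : ℕ∞) :
    minExt a s = a ∨ ∃ k : ℕ, s = k ∧ minExt a s = k := by
  rcases min_choice (ENNReal.ofReal a) (s : ℝ≥0∞) with h | h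
  · left
    rw [minExt, h, ENNReal.toReal_ofReal ha]
  · right
    have hs : s ≠ ⊤ := by
      rintro rfl
      have := min_le_left (ENNReal.ofReal a) ((⊤ : ℕ∞) : ℝ≥0∞)
      rw [h] at this
      simp at this
    lift s to ℕ using hs
    exact ⟨s, rfl, by rw [minExt, h]; simp⟩

theorem one_le_truncLog (x : ℝ) : 1 ≤ truncLog x := by
  rw [truncLog, Real.le_log_iff_exp_le (lt_max_of_lt_right (Real.exp_pos 1))]
  exact le_max_right _ _

theorem log_le_truncLog {x : ℝ} (hx : 0 < x) : Real.log x ≤ truncLog x :=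
  Real.log_le_log hx (le_max_left _ _)

theorem truncLog_le_iff {x A : ℝ} (hA : 1 ≤ A) : truncLog x ≤ A ↔ x ≤ Real.exp A := by
  rw [truncLog, Real.log_le_iff_le_exp (lt_max_of_lt_right (Real.exp_pos 1)), max_le_iff]
  simp [hA]

/-! ### Growth of a class of bounded VC dimension -/

/-- As `a ≤ 1`, each `a ^ r` may be replaced by the larger `a ^ i`, leaving part of the binomial
expansion of `(1 + a) ^ n`. The choice `a = d / k` gives the usual `(ek/d)^d` form of Sauer–Shelah.
-/
theorem sum_choose_mul_pow_le (n r : ℕ) {a : ℝ} (ha : 0 ≤ a) (ha1 : a ≤ 1) :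
    (∑ i ∈ Finset.Iic r, (n.choose i : ℝ)) * a ^ r ≤ (1 + a) ^ n := by
  calc (∑ i ∈ Finset.Iic r, (n.choose i : ℝ)) * a ^ r
      ≤ ∑ i ∈ Finset.Iic r, (n.choose i : ℝ) * a ^ i := by
        rw [Finset.sum_mul]
        refine Finset.sum_le_sum fun i hi => ?_
        gcongr ?_ * ?_
        exact pow_le_pow_of_le_one ha ha1 (Finset.mem_Iic.1 hi)
    _ ≤ ∑ i ∈ Finset.Iic r ∪ Finset.range (n + 1), (n.choose i : ℝ) * a ^ i :=
        Finset.sum_le_sum_of_subset_of_nonneg Finset.subset_union_left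
          fun i _ _ => by positivity
    _ = ∑ i ∈ Finset.range (n + 1), (n.choose i : ℝ) * a ^ i := by
        refine (Finset.sum_subset Finset.subset_union_right fun i _ hi => ?_).symm
        rw [Nat.choose_eq_zero_of_lt (by simpa using hi)]
        simp
    _ = (1 + a) ^ n := by
        rw [add_comm (1 : ℝ) a, add_pow]
        refine Finset.sum_congr rfl fun i _ => ?_
        rw [one_pow]; ring

/-- The Sauer–Shelah lemma for classes of Boolean functions. -/
theorem card_le_sum_choose {ι : Type*} [Fintype ι] {G : Set (ι → Bool)} {d : ℕ}
    (hd : vcDim G ≤ d) (Q : Finset (ι → Bool)) (hQ : ↑Q ⊆ G) :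
    Q.card ≤ ∑ i ∈ Finset.Iic d, (Fintype.card ι).choose i := by
  classical
  let φ : (ι → Bool) → Finset ι := fun p => Finset.univ.filter fun i => p i = true
  have hφ : Function.Injective φ := by
    intro p q hpq
    funext i
    have h := Finset.ext_iff.1 hpq i
    simp only [φ, Finset.mem_filter, Finset.mem_univ, true_and] at h
    exact Bool.eq_iff_iff.2 h
  have hvc : (Q.image φ).vcDim ≤ d := by
    refine Finset.sup_le fun S hS => ?_
    rw [Finset.mem_shatterer] at hS
    refine card_le_of_shattered hd fun b => ?_
    obtain ⟨u, hu, hSu⟩ := hS (t := S.filter fun i => ∃ h : i ∈ S, b ⟨i, h⟩ = true)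
      (Finset.filter_subset _ _)
    obtain ⟨p, hp, rfl⟩ := Finset.mem_image.1 hu
    refine ⟨p, hQ hp, fun i => ?_⟩
    have h := Finset.ext_iff.1 hSu i
    simp only [φ, Finset.mem_inter, Finset.mem_filter, Finset.mem_univ, true_and, i.2,
      exists_true_left] at h
    exact Bool.eq_iff_iff.2 h
  calc Q.card = (Q.image φ).card := (Finset.card_image_of_injective _ hφ).symm
    _ ≤ (Q.image φ).shatterer.card := Finset.card_le_card_shatterer _
    _ ≤ ∑ i ∈ Finset.Iic (Q.image φ).vcDim, (Fintype.card ι).choose i :=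
        Finset.card_shatterer_le_sum_vcDim
    _ ≤ _ := Finset.sum_le_sum_of_subset (Finset.Iic_subset_Iic.2 hvc)

/-- If all pairs of distinct patterns in `Q` disagree on at least `a` of the coordinates in `D`,
then some `k` coordinates of `D` separate all the patterns, for `k` large compared with
`log #Q * #D / a`. -/
theorem exists_separating_sample {ι : Type*} (D : Finset ι)
    (Q : Finset (ι → Bool)) {a : ℝ} (hD : 0 < D.card)
    (hsep : ∀ p ∈ Q, ∀ q ∈ Q, p ≠ q → a ≤ ((D.filter fun i => p i ≠ q i).card : ℝ)) (k : ℕ)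
    (hk : 2 * Real.log Q.card < k * (a / D.card)) (hQ : 0 < Q.card) :
    ∃ t : Fin k → ι, Set.InjOn (fun p : ι → Bool => p ∘ t) Q := by
  classical
  by_contra! hcon
  have hD' : (0 : ℝ) < D.card := by exact_mod_cast hD
  let T : Finset (Fin k → ι) := Fintype.piFinset fun _ => D
  let A : (ι → Bool) × (ι → Bool) → Finset (Fin k → ι) := fun pq =>
    Fintype.piFinset fun _ => D.filter fun i => pq.1 i = pq.2 i
  -- Union bound in counting form: each pair is left unseparated by a proportion at most
  -- `exp(-ka/#D)` of the tuples in `D`, and there are at most `#Q ^ 2` pairs.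
  have hcover : T ⊆ Q.offDiag.biUnion A := by
    intro t ht
    have hni := hcon t
    simp only [Set.InjOn, not_forall] at hni
    obtain ⟨p, hp, q, hq, hpq, hne⟩ := hni
    refine Finset.mem_biUnion.2 ⟨(p, q), Finset.mem_offDiag.2 ⟨hp, hq, hne⟩, ?_⟩
    simp only [A, T, Fintype.mem_piFinset, Finset.mem_filter] at ht ⊢
    exact fun j => ⟨ht j, congrFun hpq j⟩
  have hT : (T.card : ℝ) = (D.card : ℝ) ^ k := by simp [T]
  have hA : ∀ pq ∈ Q.offDiag, ((A pq).card : ℝ) ≤ (D.card * Real.exp (-(a / D.card))) ^ k := by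
    rintro ⟨p, q⟩ hpq
    obtain ⟨hp, hq, hne⟩ := Finset.mem_offDiag.1 hpq
    have h1 := hsep p hp q hq hne
    have h2 : ((D.filter fun i => p i = q i).card : ℝ) + (D.filter fun i => p i ≠ q i).card
        = D.card := by
      exact_mod_cast Finset.card_filter_add_card_filter_not (s := D) (fun i => p i = q i)
    have h3 : ((D.filter fun i => p i = q i).card : ℝ) ≤ D.card * Real.exp (-(a / D.card)) := by
      calc ((D.filter fun i => p i = q i).card : ℝ) ≤ D.card - a := by linarith
        _ = D.card * (-(a / D.card) + 1) := by field_simp; ring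
        _ ≤ _ := by gcongr; exact Real.add_one_le_exp _
    simp only [A, Fintype.card_piFinset, Finset.prod_const, Finset.card_univ, Fintype.card_fin,
      Nat.cast_pow]
    gcongr
  have h1 : (D.card : ℝ) ^ k ≤ (Q.card : ℝ) ^ 2 * (D.card * Real.exp (-(a / D.card))) ^ k := by
    rw [← hT]
    calc (T.card : ℝ) ≤ ((Q.offDiag.biUnion A).card : ℝ) := by
          exact_mod_cast Finset.card_le_card hcover
      _ ≤ ∑ pq ∈ Q.offDiag, ((A pq).card : ℝ) := by exact_mod_cast Finset.card_biUnion_le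
      _ ≤ ∑ _pq ∈ Q.offDiag, (D.card * Real.exp (-(a / D.card))) ^ k := Finset.sum_le_sum hA
      _ = (Q.offDiag.card : ℝ) * (D.card * Real.exp (-(a / D.card))) ^ k := by simp
      _ ≤ _ := by
          gcongr
          rw [sq]
          exact_mod_cast (by rw [Finset.offDiag_card]; omega :
            Q.offDiag.card ≤ Q.card * Q.card)
  have hQ' : (0 : ℝ) < Q.card := by exact_mod_cast hQ
  rw [mul_pow, ← Real.exp_nat_mul, ← Real.exp_log hQ', ← Real.exp_nat_mul, mul_left_comm,
    ← Real.exp_add] at h1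
  have h2 : Real.exp (((2 : ℕ) : ℝ) * Real.log Q.card + k * -(a / D.card)) < 1 := by
    rw [Real.exp_lt_one_iff]
    push_cast
    linarith
  have h3 : (0 : ℝ) < (D.card : ℝ) ^ k := by positivity
  nlinarith

/-- Entropy bound for separated subsets of a class of VC dimension at most `d`. -/
theorem log_card_le_of_separated {ι : Type*} {G : Set (ι → Bool)} {d : ℕ} (hd1 : 1 ≤ d)
    (hd : vcDim G ≤ d) (D : Finset ι) (Q : Finset (ι → Bool)) (hQG : ↑Q ⊆ G) {a : ℝ} (ha : 0 < a)
    (hsep : ∀ p ∈ Q, ∀ q ∈ Q, p ≠ q → a ≤ ((D.filter fun i => p i ≠ q i).card : ℝ))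
    (hQ : 2 ≤ Q.card) :
    Real.log Q.card ≤ 2 * d * Real.log (4 * Real.exp 1 * D.card / a) := by
  classical
  obtain ⟨p, hp, q, hq, hpq⟩ := Finset.one_lt_card.1 hQ
  have haD : a ≤ D.card := (hsep p hp q hq hpq).trans (by
    exact_mod_cast Finset.card_le_card (Finset.filter_subset _ _))
  have hD' : (0 : ℝ) < D.card := ha.trans_le haD
  have hD : 0 < D.card := by exact_mod_cast hD'
  have hd' : (1 : ℝ) ≤ d := by exact_mod_cast hd1
  set L := Real.log Q.card with hL
  have hQ' : (2 : ℝ) ≤ Q.card := by exact_mod_cast hQ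
  have hLhalf : 1 / 2 ≤ L := by
    have h1 := Real.log_le_log (by norm_num) hQ'
    have := Real.log_two_gt_d9
    linarith
  set u := (D.card : ℝ) / a with hu
  have hu1 : 1 ≤ u := by rwa [hu, one_le_div ha]
  have hinv : a / D.card = u⁻¹ := by rw [hu, inv_div]
  have h4 : 4 * Real.exp 1 * D.card / a = 4 * Real.exp 1 * u := by rw [hu]; ring
  have hlog1 : 1 ≤ Real.log (4 * Real.exp 1 * u) := by
    rw [Real.le_log_iff_exp_le (by positivity)]
    nlinarith [Real.exp_pos 1]
  rw [h4]
  -- Just above the sampling threshold. Since `L ≥ 1/2` and `u ≥ 1`, the added `1` is at most `2Lu`,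
  -- so `k ≤ 4Lu`.
  set k := ⌊2 * L * u⌋₊ + 1 with hk
  have hk1 : 2 * L * u < k := by rw [hk]; push_cast; exact Nat.lt_floor_add_one _
  have hk2 : (k : ℝ) ≤ 4 * L * u := by
    rw [hk]; push_cast
    have := Nat.floor_le (by positivity : 0 ≤ 2 * L * u)
    nlinarith
  obtain ⟨t, ht⟩ := exists_separating_sample D Q hD hsep k (by
    rw [hinv, ← div_eq_mul_inv, lt_div_iff₀ (by positivity)]; exact hk1) (by omega)
  have hcard : Q.card ≤ ∑ i ∈ Finset.Iic d, k.choose i := by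
    have h := card_le_sum_choose ((vcDim_image_comp_le G t).trans hd)
      (Q.image fun p => p ∘ t) (by
        intro g hg
        obtain ⟨p, hp, rfl⟩ := Finset.mem_image.1 (Finset.mem_coe.1 hg)
        exact ⟨p, hQG hp, rfl⟩)
    rwa [Finset.card_image_of_injOn ht, Fintype.card_fin] at h
  have hcard' : (Q.card : ℝ) ≤ ∑ i ∈ Finset.Iic d, (k.choose i : ℝ) := by exact_mod_cast hcard
  have hkpos : (0 : ℝ) < k := by rw [hk]; positivity
  rcases le_total k d with hkd | hkd
  · have h1 := sum_choose_mul_pow_le k d (zero_le_one) (le_refl (1 : ℝ))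
    have h2 : (Q.card : ℝ) ≤ Real.exp d := by
      calc (Q.card : ℝ) ≤ (1 + 1) ^ k := by simpa using hcard'.trans (by simpa using h1)
        _ ≤ (1 + 1) ^ d := pow_le_pow_right₀ (by norm_num) hkd
        _ ≤ (Real.exp 1) ^ d := by gcongr; exact Real.add_one_le_exp 1
        _ = Real.exp d := by rw [← Real.exp_nat_mul, mul_one]
    have h3 : L ≤ d := by rwa [hL, Real.log_le_iff_le_exp (by positivity)]
    nlinarith
  · have hkd' : (d : ℝ) ≤ k := by exact_mod_cast hkd
    have h1 := sum_choose_mul_pow_le k d (a := d / k) (by positivity)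
      ((div_le_one hkpos).2 hkd')
    have h2 : (1 + (d : ℝ) / k) ^ k ≤ Real.exp d := by
      calc (1 + (d : ℝ) / k) ^ k ≤ (Real.exp (d / k)) ^ k := by
            gcongr; rw [add_comm]; exact Real.add_one_le_exp _
        _ = Real.exp d := by
            rw [← Real.exp_nat_mul, mul_div_cancel₀ _ hkpos.ne']
    have hpos : (0 : ℝ) < (d / k) ^ d := by positivity
    have h3 : (Q.card : ℝ) * (d / k) ^ d ≤ Real.exp d :=
      (mul_le_mul_of_nonneg_right hcard' hpos.le).trans (h1.trans h2)
    have h4 : L + d * Real.log (d / k) ≤ d := by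
      have h := Real.log_le_log (by positivity) h3
      rwa [Real.log_exp, Real.log_mul (by positivity) hpos.ne', Real.log_pow] at h
    -- As `k` is itself of order `L`, Sauer–Shelah becomes the implicit inequality `y ≤ 1 + log(4u)
    -- + log y`, solved by means of `log y ≤ y / 2`.
    set y := L / d with hy
    have hypos : 0 < y := div_pos (by linarith) (by linarith)
    have h4u : 0 < 4 * u := by linarith
    have hLy : L = d * y := by
      rw [hy, mul_div_cancel₀ _ (by linarith)]
    have h5 : Real.log (k / d) ≤ Real.log (4 * u) + Real.log y := by
      rw [← Real.log_mul h4u.ne' hypos.ne']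
      refine Real.log_le_log (by positivity) ?_
      rw [div_le_iff₀ (by positivity)]
      calc (k : ℝ) ≤ 4 * L * u := hk2
        _ = 4 * u * y * d := by rw [hLy]; ring
    have h6 : Real.log (d / k) = -Real.log (k / d) := by rw [← Real.log_inv, inv_div]
    have h7 : Real.log (4 * Real.exp 1 * u) = 1 + Real.log (4 * u) := by
      rw [show 4 * Real.exp 1 * u = Real.exp 1 * (4 * u) by ring,
        Real.log_mul (Real.exp_pos 1).ne' h4u.ne', Real.log_exp]
    have h8 : Real.log y ≤ y / 2 := by
      have h := Real.log_le_sub_one_of_pos (by positivity : 0 < y / 2)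
      rw [Real.log_div hypos.ne' (by norm_num)] at h
      have := Real.log_two_lt_d9
      linarith
    have h9 : y ≤ 1 + Real.log (k / d) := by
      rw [h6, hLy] at h4
      have : (d : ℝ) * y ≤ d * (1 + Real.log (k / d)) := by linarith
      exact le_of_mul_le_mul_left this (by positivity)
    rw [hLy, h7]
    have h10 : y ≤ 2 * (1 + Real.log (4 * u)) := by linarith
    nlinarith

/-! ### The region of disagreement of a ball -/

/-- The region of disagreement with `f` of functions at distance at most `r` from `f` has at most
`s * r` points, where `s` bounds the sizes of the stars. -/
theorem card_disagreement_le {ι : Type*} [Fintype ι] {G : Set (ι → Bool)} {s : ℕ}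
    (hs : ∀ k, HasStar G k → k ≤ s) {f : ι → Bool} (hf : f ∈ G) (Q : Finset (ι → Bool))
    (hQ : ↑Q ⊆ G) {r : ℝ} (hr : 0 ≤ r) (hQr : ∀ g ∈ Q, (hammingDist f g : ℝ) ≤ r) :
    ((Finset.univ.filter fun i => ∃ g ∈ Q, f i ≠ g i).card : ℝ) ≤ s * r := by
  classical
  set D := Finset.univ.filter fun i => ∃ g ∈ Q, f i ≠ g i with hD
  let E : (ι → Bool) → Finset ι := fun g => Finset.univ.filter fun i => f i ≠ g i
  -- In a minimal cover of `D` by disagreement sets, each member has a private point covered by no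
  -- other; these points and functions form a star centred at `f`.
  obtain ⟨Q₀, -, ⟨hQ₀Q, hcov⟩, hmin⟩ := exists_minimal_le_of_wellFoundedLT
    (fun R : Finset (ι → Bool) => R ⊆ Q ∧ D ⊆ R.biUnion E) Q
    ⟨subset_rfl, fun i hi => by simpa [hD, E] using hi⟩
  have hpriv : ∀ g ∈ Q₀, ∃ i, f i ≠ g i ∧ ∀ g' ∈ Q₀, f i ≠ g' i → g' = g := by
    intro g hg
    by_contra! hcon
    have hle := hmin (y := Q₀.erase g) ⟨(Finset.erase_subset _ _).trans hQ₀Q, fun i hi => by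
      obtain ⟨g₁, hg₁, hi₁⟩ := Finset.mem_biUnion.1 (hcov hi)
      have hi₁' : f i ≠ g₁ i := by simpa [E] using hi₁
      by_cases h : g₁ = g
      · subst h
        obtain ⟨g₂, hg₂, hne, hne'⟩ := hcon i hi₁'
        exact Finset.mem_biUnion.2 ⟨g₂, Finset.mem_erase.2 ⟨hne', hg₂⟩, by simpa [E] using hne⟩
      · exact Finset.mem_biUnion.2 ⟨g₁, Finset.mem_erase.2 ⟨h, hg₁⟩, hi₁⟩⟩ (Finset.erase_subset _ _)
    exact Finset.notMem_erase g Q₀ (hle hg)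
  choose z hz hz' using hpriv
  have hstar : HasStar G Q₀.card := by
    rw [hasStar_iff]
    let e := Q₀.equivFin.symm
    refine ⟨fun j => z (e j).1 (e j).2, f, hf, fun j => (e j).1, fun j => hQ (hQ₀Q (e j).2), fun i j => ?_⟩
    constructor
    · intro h
      exact e.injective (Subtype.ext (hz' _ (e j).2 _ (e i).2 h))
    · rintro rfl
      exact hz _ (e i).2
  calc (D.card : ℝ) ≤ ((Q₀.biUnion E).card : ℝ) := by exact_mod_cast Finset.card_le_card hcov
    _ ≤ ∑ g ∈ Q₀, ((E g).card : ℝ) := by exact_mod_cast Finset.card_biUnion_le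
    _ ≤ ∑ _g ∈ Q₀, r := Finset.sum_le_sum fun g hg => hQr g (hQ₀Q hg)
    _ = Q₀.card * r := by simp
    _ ≤ s * r := by gcongr; exact hs _ hstar

/-! ### The upper bound -/

theorem log_mul_le_truncLog {u v : ℝ} (hu : 0 < u) (hv : 0 < v) :
    Real.log (8 * Real.exp 1 * (u * v)) ≤ 4 + truncLog u + truncLog v := by
  have h8 : Real.log 8 ≤ 3 := by
    rw [show (8 : ℝ) = 2 ^ 3 by norm_num, Real.log_pow]
    have := Real.log_two_lt_d9
    push_cast
    linarith
  have h := Real.exp_pos 1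
  rw [Real.log_mul (by positivity) (by positivity), Real.log_mul (by norm_num) h.ne',
    Real.log_exp, Real.log_mul hu.ne' hv.ne']
  linarith [log_le_truncLog hu, log_le_truncLog hv]

/-- A bound for separated subsets of balls bounds the local packing number. -/
theorem localPackingNumber_toNat_le {F : Set (X → Bool)} {γ : ℝ≥0} {n : ℕ} {h A : ℝ}
    (hA : ∀ (x : Fin n → X), ∀ f ∈ F, ∀ ε : ℝ≥0, γ ≤ ε → ∀ Q : Finset (Fin n → Bool),
      (↑Q ⊆ (fun g : X → Bool => g ∘ x) '' F) →
      (∀ q ∈ Q, (hammingDist (f ∘ x) q : ℝ) ≤ ε / h) →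
      (∀ p ∈ Q, ∀ q ∈ Q, p ≠ q → (ε / 2 : ℝ) < hammingDist p q) → (Q.card : ℝ) ≤ A) :
    ((localPackingNumber F γ n h).toNat : ℝ) ≤ max A 0 := by
  -- The maximum with `0` handles the case where no `x` and `f` are admissible and `hA` does not
  -- constrain `A`.
  have key : localPackingNumber F γ n h ≤ (⌊max A 0⌋₊ : ℕ) := by
    refine iSup_le fun x => iSup_le fun f => iSup_le fun hf => iSup_le fun ε => iSup_le fun hε =>
      iSup_le fun S => iSup_le fun hS => iSup_le fun hsep => ?_
    have hfin : S.Finite := Set.toFinite (α := Fin n → Bool) S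
    rw [hfin.encard_eq_coe_toFinset_card]
    suffices h : ((hfin.toFinset.card : ℕ) : ℝ) ≤ max A 0 by
      exact_mod_cast Nat.le_floor h
    refine le_max_of_le_left (hA x f hf ε hε hfin.toFinset ?_ ?_ ?_)
    · intro q hq
      obtain ⟨g, hg, rfl⟩ := hS (hfin.mem_toFinset.1 hq)
      exact ⟨g, hg.1, rfl⟩
    · intro q hq
      obtain ⟨g, hg, rfl⟩ := hS (hfin.mem_toFinset.1 hq)
      exact hg.2
    · intro p hp q hq hpq
      have h : ((ε / 2 : ℝ≥0) : ℝ≥0∞) < edist (Hamming.toHamming p) (Hamming.toHamming q) :=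
        hsep (hfin.mem_toFinset.1 hp) (hfin.mem_toFinset.1 hq) hpq
      rw [edist_nndist, ENNReal.coe_lt_coe, Hamming.nndist_eq_hammingDist] at h
      have h' : ((ε / 2 : ℝ≥0) : ℝ) < ((hammingDist p q : ℝ≥0) : ℝ) := NNReal.coe_lt_coe.2 h
      simpa using h'
  exact (Nat.cast_le.2 (ENat.toNat_le_of_le_natCast key)).trans
    (Nat.floor_le (le_max_right _ _))

theorem localFixedPoint_le {F : Set (X → Bool)} {d : ℕ} (hd : vcDim F = d) (hd1 : 1 ≤ d)
    (n : ℕ) {h : ℝ} (h0 : 0 < h) :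
    (localFixedPoint F h h n : ℝ) ≤
      10 * (d * truncLog (minExt (n * h ^ 2 / d) (starNumber F)) / h
        + d * truncLog (1 / h) / h) := by
  classical
  have hd' : (1 : ℝ) ≤ d := by exact_mod_cast hd1
  set γ := localFixedPoint F h h n with hγ
  have hmem : h * γ ≤ truncLog ((localPackingNumber F γ n h).toNat : ℝ) :=
    (localFixedPoint_isGreatest F h0 h n).1
  set T := truncLog (minExt (n * h ^ 2 / d) (starNumber F)) with hT
  set T' := truncLog (1 / h) with hT'
  have hT1 : 1 ≤ T := one_le_truncLog _
  have hT1' : 1 ≤ T' := one_le_truncLog _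
  rw [← add_div, ← mul_add, mul_div_assoc', le_div_iff₀ h0, mul_comm (γ : ℝ) h]
  have hdT : (d : ℝ) * 2 ≤ d * (T + T') := by gcongr; linarith
  -- Otherwise every `ε ≥ γ` exceeds `d / h`, which is what turns `n / ε` into `(n h² / d) / h`.
  by_cases hsmall : h * γ ≤ d
  · linarith
  push Not at hsmall
  refine hmem.trans ((truncLog_le_iff (by linarith)).2 ?_)
  refine (localPackingNumber_toNat_le (A := Real.exp (10 * (d * (T + T')))) ?_).trans_eq
    (max_eq_left (Real.exp_pos _).le)
  intro x f hf ε hε Q hQF hQr hsep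
  rcases Nat.lt_or_ge Q.card 2 with hQ | hQ
  · have : (Q.card : ℝ) ≤ 1 := by exact_mod_cast (by omega : Q.card ≤ 1)
    exact this.trans (Real.one_le_exp (by linarith))
  have hγε : (γ : ℝ) ≤ ε := by exact_mod_cast hε
  have hεpos : (0 : ℝ) < ε := by
    have : 0 < h * γ := by linarith
    exact (pos_of_mul_pos_right this h0.le).trans_le hγε
  set G := (fun g : X → Bool => g ∘ x) '' F with hG
  have hfG : f ∘ x ∈ G := ⟨f, hf, rfl⟩
  set D := Finset.univ.filter fun i => ∃ g ∈ Q, (f ∘ x) i ≠ g i with hD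
  -- Outside `D` every member of `Q` agrees with `f`, so the entropy bound can use `#D` in place of
  -- `n`.
  have hdist : ∀ p ∈ Q, ∀ q ∈ Q, hammingDist p q = (D.filter fun i => p i ≠ q i).card := by
    intro p hp q hq
    unfold hammingDist
    congr 1
    ext i
    simp only [hD, Finset.mem_filter, Finset.mem_univ, true_and, iff_and_self]
    intro hne
    by_cases hfp : (f ∘ x) i = p i
    · exact ⟨q, hq, by rwa [hfp]⟩
    · exact ⟨p, hp, hfp⟩
  have hmain := log_card_le_of_separated hd1 ((vcDim_image_comp_le F x).trans hd.le) D Q hQF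
    (a := ε / 2) (by positivity)
    (fun p hp q hq hpq => by rw [← hdist p hp q hq]; exact (hsep p hp q hq hpq).le) hQ
  have hDpos : (0 : ℝ) < D.card := by
    obtain ⟨p, hp, q, hq, hpq⟩ := Finset.one_lt_card.1 hQ
    have h2 := hsep p hp q hq hpq
    rw [hdist p hp q hq] at h2
    have h3 : ((D.filter fun i => p i ≠ q i).card : ℝ) ≤ D.card := by
      exact_mod_cast Finset.card_le_card (Finset.filter_subset _ _)
    linarith
  -- `u` is whichever of `n h² / d` and the star number attains the minimum.
  have hratio : ∃ u : ℝ, 0 < u ∧ truncLog u = T ∧ (D.card : ℝ) / ε ≤ u * (1 / h) := by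
    have hDn : (D.card : ℝ) ≤ n := by
      exact_mod_cast (Finset.card_le_univ D).trans_eq (Fintype.card_fin n)
    have hn : (0 : ℝ) < n := hDpos.trans_le hDn
    rcases minExt_eq_or (a := n * h ^ 2 / d) (by positivity) (starNumber F) with he | ⟨s, hs, he⟩
    · refine ⟨n * h ^ 2 / d, by positivity, by rw [hT, he], ?_⟩
      have h2 : (n * h ^ 2 / d) * (1 / h) = n / (d / h) := by field_simp
      rw [h2]
      have h3 : (d : ℝ) / h ≤ ε := by
        rw [div_le_iff₀ h0, mul_comm]
        exact hsmall.le.trans (by gcongr)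
      gcongr
    · have hstar : ∀ k, HasStar G k → k ≤ s := by
        intro k hk
        have h2 : (k : ℕ∞) ≤ starNumber F := le_iSup₂_of_le k hk.of_comp le_rfl
        rw [hs] at h2
        exact_mod_cast h2
      have h2 := card_disagreement_le hstar hfG Q hQF (r := ε / h) (by positivity) hQr
      have h3 : (D.card : ℝ) / ε ≤ s * (1 / h) := by
        rw [div_le_iff₀ hεpos]
        calc (D.card : ℝ) ≤ s * (ε / h) := h2
          _ = _ := by ring
      refine ⟨s, ?_, by rw [hT, he], h3⟩
      have h4 : 0 < (s : ℝ) * (1 / h) := (by positivity : (0 : ℝ) < D.card / ε).trans_le h3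
      exact pos_of_mul_pos_left h4 (by positivity)
  obtain ⟨u, hu, huT, hDu⟩ := hratio
  have hlog : Real.log (4 * Real.exp 1 * D.card / (ε / 2)) ≤ 4 + T + T' := by
    rw [← huT, hT']
    refine le_trans ?_ (log_mul_le_truncLog hu (by positivity : 0 < 1 / h))
    have he := Real.exp_pos 1
    refine Real.log_le_log (by positivity) ?_
    calc 4 * Real.exp 1 * D.card / (ε / 2) = 8 * Real.exp 1 * (D.card / ε) := by
          field_simp; ring
      _ ≤ _ := by gcongr
  rw [← Real.log_le_iff_le_exp (by positivity)]
  calc Real.log Q.card ≤ 2 * d * (4 + T + T') := hmain.trans (by gcongr)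
    _ ≤ 2 * d * (5 * (T + T')) := by gcongr; linarith
    _ = _ := by ring

/-! ### The lower bound -/

theorem le_localFixedPoint {F : Set (X → Bool)} {h : ℝ} (h0 : 0 < h) {n γ : ℕ}
    (hγ : h * γ ≤ truncLog ((localPackingNumber F γ n h).toNat : ℝ)) :
    γ ≤ localFixedPoint F h h n :=
  (localFixedPoint_isGreatest F h0 h n).2 hγ

/-- The truncated logarithm is at least `1`, so `⌊1/h⌋` always lies in the fixed point set. This
absorbs the degenerate cases of the lower bound. -/
theorem inv_le_localFixedPoint (F : Set (X → Bool)) {h : ℝ} (h0 : 0 < h) (h1 : h ≤ 1) (n : ℕ) :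
    1 / h ≤ 2 * (localFixedPoint F h h n : ℝ) := by
  have hle : ⌊1 / h⌋₊ ≤ localFixedPoint F h h n := by
    refine le_localFixedPoint h0 (le_trans ?_ (one_le_truncLog _))
    calc h * (⌊1 / h⌋₊ : ℝ) ≤ h * (1 / h) := by gcongr; exact Nat.floor_le (by positivity)
      _ = 1 := by field_simp
  have hle' : ((⌊1 / h⌋₊ : ℕ) : ℝ) ≤ localFixedPoint F h h n := by exact_mod_cast hle
  have hone : 1 ≤ 1 / h := by rwa [one_le_div h0]
  have h2 : (1 : ℝ) ≤ ⌊1 / h⌋₊ := by exact_mod_cast Nat.one_le_floor_iff _ |>.2 hone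
  have h3 := Nat.lt_floor_add_one (1 / h)
  linarith

/-- Every point of a finite set can be repeated `k` times among `n` indices, up to a dummy point. -/
theorem exists_repetition (α : Type*) [Fintype α] {k n : ℕ} (hkn : Fintype.card α * k ≤ n) :
    ∃ φ : Fin n → Option α, ∀ u v : Option α → Bool, u none = v none →
      hammingDist (u ∘ φ) (v ∘ φ) = hammingDist (u ∘ some) (v ∘ some) * k := by
  classical
  obtain ⟨e⟩ : Nonempty (α × Fin k ↪ Fin n) :=
    Function.Embedding.nonempty_of_card_le (by simpa using hkn)
  -- Each point receives a block of `k` indices; the remaining indices go to `none`, where `u` and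
  -- `v` agree.
  refine ⟨Function.extend e (fun p => some p.1) fun _ => none, fun u v huv => ?_⟩
  have hset : (Finset.univ.filter fun i =>
      (u ∘ Function.extend e (fun p => some p.1) fun _ => none) i ≠
        (v ∘ Function.extend e (fun p => some p.1) fun _ => none) i) =
      ((Finset.univ.filter fun a => (u ∘ some) a ≠ (v ∘ some) a) ×ˢ
        (Finset.univ : Finset (Fin k))).map e := by
    ext i
    simp only [Finset.mem_filter, Finset.mem_univ, true_and, Finset.mem_map, Finset.mem_product,
      and_true, Function.comp_apply]
    by_cases hi : ∃ p, e p = i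
    · obtain ⟨p, rfl⟩ := hi
      rw [e.injective.extend_apply]
      constructor
      · exact fun hp => ⟨p, hp, rfl⟩
      · rintro ⟨p', hp', hpe⟩
        rwa [e.injective hpe] at hp'
    · rw [Function.extend_apply' _ _ _ hi]
      constructor
      · exact fun h => absurd huv h
      · rintro ⟨p, -, hp⟩
        exact absurd ⟨p, hp⟩ hi
  unfold hammingDist
  rw [hset, Finset.card_map, Finset.card_product, Finset.card_univ, Fintype.card_fin]

/-- Lower bound for the fixed point by a separated family supported on a few points, repeated. -/
theorem le_localFixedPoint_of_separated {F : Set (X → Bool)} {h : ℝ} (h0 : 0 < h) (h1 : h ≤ 1)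
    {α κ : Type*} [Fintype α] (y : Option α → X) {f₀ : X → Bool} (hf₀ : f₀ ∈ F) (C : Finset κ)
    (g : κ → X → Bool) (hg : ∀ c ∈ C, g c ∈ F) (hnone : ∀ c ∈ C, f₀ (y none) = g c (y none))
    {r k n γ : ℕ} (hkn : Fintype.card α * k ≤ n)
    (hr : ∀ c ∈ C, hammingDist (f₀ ∘ y ∘ some) (g c ∘ y ∘ some) ≤ r)
    (hsep : ∀ c ∈ C, ∀ c' ∈ C, c ≠ c' →
      r < 2 * hammingDist (g c ∘ y ∘ some) (g c' ∘ y ∘ some))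
    (hγk : γ ≤ r * k) (hγ : h * γ ≤ Real.log C.card) :
    γ ≤ localFixedPoint F h h n := by
  classical
  rcases Nat.eq_zero_or_pos k with rfl | hk
  · simp only [mul_zero, nonpos_iff_eq_zero] at hγk
    simp [hγk]
  rcases C.eq_empty_or_nonempty with rfl | hC
  · have h2 : h * γ ≤ 0 := by simpa using hγ
    have h3 : (γ : ℝ) ≤ 0 := nonpos_of_mul_nonpos_right h2 h0
    have h4 : γ ≤ 0 := by exact_mod_cast h3
    omega
  obtain ⟨φ, hφ⟩ := exists_repetition α hkn
  set x : Fin n → X := y ∘ φ with hx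
  have hd₀ : ∀ c ∈ C, hammingDist (f₀ ∘ x) (g c ∘ x) ≤ r * k := by
    intro c hc
    have h2 := hφ (f₀ ∘ y) (g c ∘ y) (hnone c hc)
    exact h2.trans_le (Nat.mul_le_mul_right k (hr c hc))
  have hd : ∀ c ∈ C, ∀ c' ∈ C, c ≠ c' → r * k < 2 * hammingDist (g c ∘ x) (g c' ∘ x) := by
    intro c hc c' hc' hne
    have h2 : hammingDist (g c ∘ x) (g c' ∘ x) =
        hammingDist (g c ∘ y ∘ some) (g c' ∘ y ∘ some) * k :=
      hφ (g c ∘ y) (g c' ∘ y) ((hnone c hc).symm.trans (hnone c' hc'))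
    rw [h2, ← mul_assoc]
    exact Nat.mul_lt_mul_of_pos_right (hsep c hc c' hc' hne) hk
  have hinj : Set.InjOn (fun c => project x (g c)) C := by
    intro c hc c' hc' hcc
    by_contra hne
    have h2 := hd c hc c' hc' hne
    rw [show g c ∘ x = g c' ∘ x from hcc, hammingDist_self] at h2
    omega
  have hpack : (C.card : ℕ∞) ≤ localPackingNumber F γ n h := by
    have hε : (γ : ℝ≥0) ≤ ((r * k : ℕ) : ℝ≥0) := by exact_mod_cast hγk
    have hencard : ((fun c => project x (g c)) '' (C : Set κ)).encard = C.card := by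
      rw [hinj.encard_image, Set.encard_coe_eq_coe_finsetCard]
    rw [← hencard]
    -- The scale is `ε = r * k`. The family already lies within `ε` of `f₀`, hence within `ε / h`.
    refine le_trans (Metric.IsSeparated.encard_le_packingNumber
      (ε := ((r * k : ℕ) : ℝ≥0) / 2)
      (A := project x '' hammingBall F x f₀ (((r * k : ℕ) : ℝ≥0) / h)) ?_ ?_) ?_
    · rintro _ ⟨c, hc, rfl⟩
      refine ⟨g c, ⟨hg c hc, ?_⟩, rfl⟩
      have h2 : ((hammingDist (f₀ ∘ x) (g c ∘ x) : ℕ) : ℝ) ≤ (r * k : ℕ) := by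
        exact_mod_cast hd₀ c hc
      refine h2.trans ?_
      rw [NNReal.coe_natCast]
      exact le_div_self (by positivity) h0 h1
    · rintro _ ⟨c, hc, rfl⟩ _ ⟨c', hc', rfl⟩ hne
      have hcc : c ≠ c' := fun hcc => hne (by rw [hcc])
      show _ < edist (project x (g c)) (project x (g c'))
      rw [edist_nndist, ENNReal.coe_lt_coe, Hamming.nndist_eq_hammingDist,
        div_lt_iff₀ (by norm_num), mul_comm _ (2 : ℝ≥0)]
      exact_mod_cast hd c hc c' hc' hcc
    · exact le_iSup_of_le x (le_iSup₂_of_le f₀ hf₀ (le_iSup₂_of_le _ hε le_rfl))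
  have hcard : C.card ≤ (localPackingNumber F γ n h).toNat := by
    have hfin : localPackingNumber F γ n h ≠ ⊤ :=
      ne_top_of_le_ne_top (ENat.natCast_ne_top _) (localPackingNumber_le F γ n h)
    rw [← ENat.natCast_toNat hfin] at hpack
    exact_mod_cast hpack
  have hCpos : (0 : ℝ) < C.card := by exact_mod_cast hC.card_pos
  have hcard' : (C.card : ℝ) ≤ (localPackingNumber F γ n h).toNat := by exact_mod_cast hcard
  exact le_localFixedPoint h0 (hγ.trans ((Real.log_le_log hCpos hcard').trans
    (log_le_truncLog (hCpos.trans_le hcard'))))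

/-! ### Codes in the Boolean cube -/

/-- Volume of Hamming balls in the Boolean cube. -/
theorem card_hammingBall_mul_pow_le {q : ℕ} (v : Fin q → Bool) (r : ℕ) {a : ℝ} (ha : 0 ≤ a)
    (ha1 : a ≤ 1) :
    ((Finset.univ.filter fun w : Fin q → Bool => hammingDist v w ≤ r).card : ℝ) * a ^ r
      ≤ (1 + a) ^ q := by
  -- Chernoff's method: the weight `a ^ hammingDist v w` factors over coordinates, so its sum over
  -- the cube is `(1 + a) ^ q`.
  have hprod : ∀ w : Fin q → Bool,
      a ^ hammingDist v w = ∏ i, (if v i ≠ w i then a else 1) := by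
    intro w
    rw [Finset.prod_ite]
    simp [hammingDist]
  calc ((Finset.univ.filter fun w : Fin q → Bool => hammingDist v w ≤ r).card : ℝ) * a ^ r
      = ∑ w ∈ Finset.univ.filter fun w : Fin q → Bool => hammingDist v w ≤ r, a ^ r := by simp
    _ ≤ ∑ w ∈ Finset.univ.filter fun w : Fin q → Bool => hammingDist v w ≤ r,
          a ^ hammingDist v w :=
        Finset.sum_le_sum fun w hw => pow_le_pow_of_le_one ha ha1 (Finset.mem_filter.1 hw).2
    _ ≤ ∑ w : Fin q → Bool, a ^ hammingDist v w :=
        Finset.sum_le_sum_of_subset_of_nonneg (Finset.filter_subset _ _)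
          fun w _ _ => by positivity
    _ = ∏ i : Fin q, ∑ b : Bool, (if v i ≠ b then a else 1) := by
        rw [Fintype.prod_sum]
        exact Finset.sum_congr rfl fun w _ => hprod w
    _ = ∏ _i : Fin q, (1 + a) := by
        refine Finset.prod_congr rfl fun i _ => ?_
        cases v i <;> simp [add_comm]
    _ = (1 + a) ^ q := by simp

/-- The Varshamov–Gilbert bound. -/
theorem exists_code (q : ℕ) : ∃ C : Finset (Fin q → Bool),
    (∀ c ∈ C, ∀ c' ∈ C, c ≠ c' → q < 4 * hammingDist c c') ∧ (q : ℝ) / 8 ≤ Real.log C.card := by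
  classical
  obtain ⟨C, -, hC, hmax⟩ := exists_maximal_ge_of_wellFoundedGT
    (fun C : Finset (Fin q → Bool) => ∀ c ∈ C, ∀ c' ∈ C, c ≠ c' → q < 4 * hammingDist c c') ∅
    (by simp)
  refine ⟨C, hC, ?_⟩
  have hcov : (Finset.univ : Finset (Fin q → Bool)) ⊆
      C.biUnion fun c => Finset.univ.filter fun w => hammingDist c w ≤ q / 4 := by
    intro w _
    by_contra hcon
    simp only [Finset.mem_biUnion, Finset.mem_filter, Finset.mem_univ, true_and, not_exists,
      not_and, not_le] at hcon
    have hfar : ∀ c ∈ C, q < 4 * hammingDist c w := fun c hc => by have := hcon c hc; omega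
    have hle := hmax (y := insert w C) (by
      intro c hc c' hc' hne
      rcases Finset.mem_insert.1 hc with hw | hcC <;>
        rcases Finset.mem_insert.1 hc' with hw' | hcC'
      · exact absurd (hw.trans hw'.symm) hne
      · rw [hw, hammingDist_comm]; exact hfar c' hcC'
      · rw [hw']; exact hfar c hcC
      · exact hC c hcC c' hcC' hne) (Finset.subset_insert _ _)
    have hw := hfar w (hle (Finset.mem_insert_self w C))
    rw [hammingDist_self] at hw
    omega
  -- The weight `1/3` is the odds ratio of the relative radius `1/4`, the optimal choice in the
  -- volume bound.
  have hcard : (2 : ℝ) ^ q * (1 / 3) ^ (q / 4) ≤ C.card * (4 / 3) ^ q := by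
    calc (2 : ℝ) ^ q * (1 / 3) ^ (q / 4)
        = ((Finset.univ : Finset (Fin q → Bool)).card : ℝ) * (1 / 3) ^ (q / 4) := by simp
      _ ≤ (∑ c ∈ C, ((Finset.univ.filter fun w => hammingDist c w ≤ q / 4).card : ℝ))
            * (1 / 3) ^ (q / 4) := by
          gcongr
          exact_mod_cast (Finset.card_le_card hcov).trans Finset.card_biUnion_le
      _ ≤ ∑ _c ∈ C, (4 / 3 : ℝ) ^ q := by
          rw [Finset.sum_mul]
          refine Finset.sum_le_sum fun c _ => ?_
          have h := card_hammingBall_mul_pow_le c (q / 4) (a := 1 / 3) (by norm_num) (by norm_num)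
          norm_num at h ⊢
          exact h
      _ = _ := by simp
  have hCpos : (0 : ℝ) < C.card := by
    by_contra! hle
    have h2 : (C.card : ℝ) * (4 / 3) ^ q ≤ 0 := mul_nonpos_of_nonpos_of_nonneg hle (by positivity)
    have h3 : (0 : ℝ) < 2 ^ q * (1 / 3) ^ (q / 4) := by positivity
    linarith
  have hlog := Real.log_le_log (by positivity) hcard
  rw [Real.log_mul (by positivity) (by positivity), Real.log_mul hCpos.ne' (by positivity),
    Real.log_pow, Real.log_pow, Real.log_pow] at hlog
  have hq4 : ((q / 4 : ℕ) : ℝ) ≤ q / 4 := by exact_mod_cast Nat.cast_div_le (α := ℝ)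
  -- The right side equals `log(27/16) / 4`, and `27/16 ≥ exp(1/2)`.
  have hnum : 1 / 8 ≤ Real.log 2 - Real.log 3 / 4 - Real.log (4 / 3) := by
    have h2 : Real.exp (1 / 2) ≤ 27 / 16 := by
      have := Real.exp_one_lt_d9
      have h3 : Real.exp (1 / 2) ^ 2 = Real.exp 1 := by rw [← Real.exp_nat_mul]; norm_num
      have := Real.exp_pos (1 / 2)
      nlinarith
    have h3 : 1 / 2 ≤ Real.log (27 / 16) := (Real.le_log_iff_exp_le (by norm_num)).2 h2
    have h4 : Real.log (27 / 16) = 3 * Real.log 3 - 4 * Real.log 2 := by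
      rw [Real.log_div (by norm_num) (by norm_num), show (27 : ℝ) = 3 ^ 3 by norm_num,
        show (16 : ℝ) = 2 ^ 4 by norm_num, Real.log_pow, Real.log_pow]
      push_cast; ring
    have h5 : Real.log (4 / 3) = 2 * Real.log 2 - Real.log 3 := by
      rw [Real.log_div (by norm_num) (by norm_num), show (4 : ℝ) = 2 ^ 2 by norm_num, Real.log_pow]
      push_cast; ring
    linarith
  rw [one_div, Real.log_inv] at hlog
  have h3 : 0 < Real.log 3 := Real.log_pos (by norm_num)
  have h5 : ((q / 4 : ℕ) : ℝ) * Real.log 3 ≤ q / 4 * Real.log 3 := by gcongr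
  have h6 : (q : ℝ) * (1 / 8) ≤ q * (Real.log 2 - Real.log 3 / 4 - Real.log (4 / 3)) := by gcongr
  linarith

/-! ### Lower bounds from shattered sets and from stars -/

theorem le_three_mul_of_floor_le {y : ℝ} {a : ℕ} (ha : 1 ≤ a) (h : ⌊y⌋₊ ≤ a) : y ≤ 3 * a := by
  have h2 := Nat.lt_floor_add_one y
  have h3 : (⌊y⌋₊ : ℝ) ≤ a := by exact_mod_cast h
  have h4 : (1 : ℝ) ≤ a := by exact_mod_cast ha
  linarith

theorem half_le_floor {y : ℝ} (hy : 1 ≤ y) : y / 2 ≤ ⌊y⌋₊ := by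
  have h2 := Nat.lt_floor_add_one y
  have h3 : (1 : ℝ) ≤ ⌊y⌋₊ := by exact_mod_cast Nat.one_le_floor_iff _ |>.2 hy
  linarith

theorem one_le_localFixedPoint (F : Set (X → Bool)) {h : ℝ} (h0 : 0 < h) (h1 : h ≤ 1) (n : ℕ) :
    1 ≤ localFixedPoint F h h n := by
  have h2 := inv_le_localFixedPoint F h0 h1 n
  have h3 : 1 ≤ 1 / h := by rwa [one_le_div h0]
  by_contra! h4
  have h5 : localFixedPoint F h h n = 0 := by omega
  rw [h5] at h2
  norm_num at h2 h3
  linarith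

/-- The part of the lower bound that comes from a shattered set. -/
theorem vcDim_le_localFixedPoint {F : Set (X → Bool)} {d : ℕ} (hd : vcDim F = d) (hd1 : 1 ≤ d)
    {n : ℕ} (hdn : d ≤ n) {h : ℝ} (h0 : 0 < h) (h1 : h ≤ 1) :
    min (d / h) (Real.sqrt (d * n)) ≤ 144 * (localFixedPoint F h h n : ℝ) := by
  classical
  have hinv := inv_le_localFixedPoint F h0 h1 n
  have hone := one_le_localFixedPoint F h0 h1 n
  set Γ := localFixedPoint F h h n with hΓ
  have hd' : (1 : ℝ) ≤ d := by exact_mod_cast hd1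
  have hdn' : (d : ℝ) ≤ n := by exact_mod_cast hdn
  rcases Nat.lt_or_ge d 3 with hd3 | hd3
  · refine (min_le_left _ _).trans ?_
    have h2 : (d : ℝ) ≤ 2 := by exact_mod_cast (by omega : d ≤ 2)
    calc (d : ℝ) / h = d * (1 / h) := by ring
      _ ≤ 2 * (2 * Γ) := by gcongr
      _ ≤ 144 * Γ := by linarith [(Nat.cast_nonneg Γ : (0 : ℝ) ≤ Γ)]
  obtain ⟨S, hS, hcS⟩ := exists_shattered_of_le_vcDim hd1 hd.ge
  -- The shattered set must hold `q` pairs of points and one dummy point, `2q + 1 ≤ d`, which is why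
  -- `d < 3` is treated apart.
  set q := (d - 1) / 2 with hq
  set k := n / d with hk
  obtain ⟨e⟩ : Nonempty (Option (Fin q × Bool) ↪ S) :=
    Function.Embedding.nonempty_of_card_le (by
      simp only [Fintype.card_option, Fintype.card_prod, Fintype.card_fin, Fintype.card_bool,
        Fintype.card_coe]
      omega)
  have hlab : ∀ l : Option (Fin q × Bool) → Bool, ∃ f ∈ F, ∀ o, f (e o) = l o := by
    intro l
    obtain ⟨f, hf, hfl⟩ := hS (Function.extend e l fun _ => false)
    exact ⟨f, hf, fun o => by rw [hfl, e.injective.extend_apply]⟩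
  obtain ⟨f₀, hf₀, hf₀l⟩ := hlab fun _ => false
  -- Each bit is written on a pair of points, exactly one of which is labelled true. Mutual
  -- distances double, to more than `q / 2`, while the distance to `f₀` stays `q`, as separation at
  -- half the radius requires.
  choose g hg hgl using fun c : Fin q → Bool =>
    hlab fun o => o.elim false fun p => decide (c p.1 = p.2)
  obtain ⟨C, hC, hClog⟩ := exists_code q
  have hdist₀ : ∀ c, hammingDist (f₀ ∘ (fun o => (e o).1) ∘ some)
      (g c ∘ (fun o => (e o).1) ∘ some) = q := by
    intro c
    have hset : (Finset.univ.filter fun p : Fin q × Bool =>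
        (f₀ ∘ (fun o => (e o).1) ∘ some) p ≠ (g c ∘ (fun o => (e o).1) ∘ some) p) =
        Finset.univ.image fun i => (i, c i) := by
      ext ⟨i, b⟩
      simp only [Function.comp_apply, hf₀l, hgl, Option.elim_some, Finset.mem_filter,
        Finset.mem_univ, true_and, Finset.mem_image, Prod.mk.injEq]
      simp [eq_comm]
    unfold hammingDist
    rw [hset, Finset.card_image_of_injective _ fun i j hij => (Prod.ext_iff.1 hij).1,
      Finset.card_univ, Fintype.card_fin]
  have hdist : ∀ c c', hammingDist (g c ∘ (fun o => (e o).1) ∘ some)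
      (g c' ∘ (fun o => (e o).1) ∘ some) = 2 * hammingDist c c' := by
    intro c c'
    have hset : (Finset.univ.filter fun p : Fin q × Bool =>
        (g c ∘ (fun o => (e o).1) ∘ some) p ≠ (g c' ∘ (fun o => (e o).1) ∘ some) p) =
        (Finset.univ.filter fun i => c i ≠ c' i) ×ˢ Finset.univ := by
      ext ⟨i, b⟩
      simp only [Function.comp_apply, hgl, Option.elim_some, Finset.mem_filter,
        Finset.mem_univ, true_and, Finset.mem_product, and_true]
      cases c i <;> cases c' i <;> cases b <;> simp
    unfold hammingDist
    rw [hset, Finset.card_product, Finset.card_univ, Fintype.card_bool, mul_comm]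
  have hmin : min (q * k) ⌊(q : ℝ) / 8 / h⌋₊ ≤ Γ := by
    refine le_localFixedPoint_of_separated h0 h1 (fun o => (e o).1) hf₀ C g (fun c _ => hg c)
      (fun c _ => by simp only [hf₀l, hgl, Option.elim_none]) (r := q) (k := k) ?_
      (fun c _ => (hdist₀ c).le) (fun c hc c' hc' hne => ?_) (min_le_left _ _) ?_
    · simp only [Fintype.card_prod, Fintype.card_fin, Fintype.card_bool]
      calc q * 2 * k ≤ d * k := Nat.mul_le_mul_right k (by omega)
        _ ≤ n := Nat.mul_div_le n d
    · rw [hdist, ← mul_assoc]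
      exact hC c hc c' hc' hne
    · refine le_trans ?_ hClog
      calc h * ((min (q * k) ⌊(q : ℝ) / 8 / h⌋₊ : ℕ) : ℝ) ≤ h * ((q : ℝ) / 8 / h) := by
            gcongr
            refine le_trans ?_ (Nat.floor_le (by positivity))
            exact_mod_cast min_le_right _ _
        _ = q / 8 := by field_simp
  have hqd : (d : ℝ) / 6 ≤ q := by
    have h2 : d ≤ 6 * q := by omega
    have h3 : (d : ℝ) ≤ 6 * q := by exact_mod_cast h2
    linarith
  rcases min_le_iff.1 hmin with hle | hle
  · refine (min_le_right _ _).trans ?_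
    have h2 : ((q * k : ℕ) : ℝ) ≤ Γ := by exact_mod_cast hle
    have h3 : (n : ℝ) / d / 2 ≤ k := by
      have h4 := half_le_floor (y := (n : ℝ) / d) (by rwa [one_le_div (by positivity)])
      rwa [Nat.floor_div_eq_div] at h4
    -- When the number of repetitions is the limiting factor, the fixed point is even of order `n`,
    -- which dominates `√(dn)` because `d ≤ n`.
    have h4 : Real.sqrt (d * n) ≤ n := by
      rw [Real.sqrt_le_left (by positivity), sq]
      gcongr
    have h5 : (d : ℝ) / 6 * (n / d / 2) ≤ q * k := by gcongr
    have h6 : (d : ℝ) / 6 * (n / d / 2) = n / 12 := by field_simp; ring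
    push_cast at h2
    linarith [(Nat.cast_nonneg Γ : (0 : ℝ) ≤ Γ)]
  · refine (min_le_left _ _).trans ?_
    have h2 := le_three_mul_of_floor_le hone hle
    have h3 : (d : ℝ) / h / 48 ≤ q / 8 / h := by
      calc (d : ℝ) / h / 48 = d / 6 / 8 / h := by ring
        _ ≤ _ := by gcongr
    linarith

/-- The part of the lower bound that comes from a star. -/
theorem log_le_localFixedPoint_of_hasStar {F : Set (X → Bool)} {h : ℝ} (h0 : 0 < h) (h1 : h ≤ 1)
    {m k n γ : ℕ} (hstar : HasStar F (m + 1)) (hmk : m * k ≤ n) (hγk : γ ≤ k)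
    (hγ : h * γ ≤ Real.log m) : γ ≤ localFixedPoint F h h n := by
  classical
  obtain ⟨x, f₀, hf₀, f, hf, hx⟩ := hasStar_iff.1 hstar
  have hx' : ∀ i j, f i (x j) = if i = j then !f₀ (x j) else f₀ (x j) := by
    intro i j
    have h2 := hx i j
    split_ifs with hij
    · have h3 := h2.2 hij
      exact (Bool.eq_not_of_ne h3.symm)
    · by_contra h3
      exact hij (h2.1 (Ne.symm h3))
  -- The star point of index `0` is the dummy: `f₀` and every `f i` with `i ≠ 0` agree there. This
  -- uses up one point of the star.
  let y : Option (Fin m) → X := fun o => x (o.elim 0 Fin.succ)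
  have hdist₀ : ∀ c : Fin m, hammingDist (f₀ ∘ y ∘ some) (f c.succ ∘ y ∘ some) = 1 := by
    intro c
    unfold hammingDist
    rw [Finset.card_eq_one]
    refine ⟨c, ?_⟩
    ext i
    simp [y, hx', eq_comm]
  refine le_localFixedPoint_of_separated h0 h1 y hf₀ (Finset.univ : Finset (Fin m))
    (fun c => f c.succ) (fun c _ => hf _) (fun c _ => ?_) (r := 1) (k := k) (by simpa using hmk)
    (fun c _ => (hdist₀ c).le) (fun c _ c' _ hne => ?_) (by simpa using hγk) (by simpa using hγ)
  · simp [y, hx', Fin.succ_ne_zero]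
  · have hpos : 0 < hammingDist (f c.succ ∘ y ∘ some) (f c'.succ ∘ y ∘ some) := by
      rw [hammingDist_pos]
      intro heq
      have h2 := congrFun heq c
      simp [y, hx', Ne.symm hne] at h2
    omega

/-- With `m + 1` star points, about `min(h√n, s)` in number, each of the `m` points is repeated `n /
m ≳ √n / h` times, which exceeds `log v / h` up to a constant. Hence no cap by `√(dn)` is needed for
this term. -/
theorem truncLog_le_localFixedPoint (F : Set (X → Bool)) {h : ℝ} (h0 : 0 < h) (h1 : h ≤ 1)
    (n : ℕ) :
    truncLog (minExt (n * h ^ 2) (starNumber F)) / h ≤ 16 * (localFixedPoint F h h n : ℝ) := by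
  have hinv := inv_le_localFixedPoint F h0 h1 n
  have hone := one_le_localFixedPoint F h0 h1 n
  set Γ := localFixedPoint F h h n with hΓ
  set v := minExt (n * h ^ 2) (starNumber F) with hv
  rcases le_or_gt (truncLog v) 8 with hL | hL
  · calc truncLog v / h = truncLog v * (1 / h) := by ring
      _ ≤ 8 * (2 * Γ) := by gcongr
      _ = 16 * Γ := by ring
  have hv8 : Real.exp 8 < v := by
    by_contra! hle
    exact absurd ((truncLog_le_iff (by norm_num)).2 hle) (not_le.2 hL)
  have hvpos : 0 < v := (Real.exp_pos 8).trans hv8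
  have hv16 : 16 < v := by
    have h2 : (2 : ℝ) ≤ Real.exp 1 := by have := Real.add_one_le_exp (1 : ℝ); linarith
    have h3 : Real.exp 8 = Real.exp 1 ^ 8 := by rw [← Real.exp_nat_mul]; norm_num
    have h4 : (2 : ℝ) ^ 8 ≤ Real.exp 1 ^ 8 := by gcongr
    norm_num at h4
    linarith
  have hLv : truncLog v = Real.log v := by
    rw [truncLog, max_eq_left]
    exact (Real.exp_le_exp.2 (by norm_num)).trans hv8.le
  have hvn : v ≤ n * h ^ 2 := minExt_le_left (by positivity) _
  have hnpos : (0 : ℝ) < n := by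
    by_contra! hle
    have : (n : ℝ) * h ^ 2 ≤ 0 := mul_nonpos_of_nonpos_of_nonneg hle (by positivity)
    linarith
  have hsv4 : 4 < Real.sqrt v := by rw [Real.lt_sqrt (by norm_num)]; linarith
  have hsv : Real.sqrt v ≤ h * Real.sqrt n := by
    refine (Real.sqrt_le_sqrt hvn).trans_eq ?_
    rw [Real.sqrt_mul (by positivity), Real.sqrt_sq h0.le, mul_comm]
  set A := ⌊h * Real.sqrt n⌋₊ with hA
  have hA1 : (A : ℝ) ≤ h * Real.sqrt n := Nat.floor_le (by positivity)
  have hA2 : Real.sqrt v / 2 ≤ A :=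
    le_trans (by linarith) (half_le_floor (y := h * Real.sqrt n) (by linarith))
  obtain ⟨M, hMA, hMv, hMstar⟩ : ∃ M : ℕ, M ≤ A ∧ Real.sqrt v / 2 ≤ M ∧ HasStar F M := by
    rcases le_total (A : ℕ∞) (starNumber F) with hle | hle
    · refine ⟨A, le_rfl, hA2, hasStar_of_le_starNumber ?_ hle⟩
      have : (1 : ℝ) ≤ A := by linarith
      exact_mod_cast this
    · have hfin : starNumber F ≠ ⊤ := ne_top_of_le_ne_top (ENat.natCast_ne_top A) hle
      obtain ⟨s, hs⟩ := ENat.ne_top_iff_exists.1 hfin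
      have hvs : v ≤ s := by rw [hv, ← hs]; exact minExt_le_right _ _
      refine ⟨s, by rw [← hs] at hle; exact_mod_cast hle, ?_, hasStar_of_le_starNumber ?_ hs.le⟩
      · have h2 := Real.sq_sqrt hvpos.le
        nlinarith
      · have : (1 : ℝ) ≤ s := by linarith
        exact_mod_cast this
  obtain ⟨m, rfl⟩ : ∃ m, M = m + 1 := by
    refine ⟨M - 1, ?_⟩
    have h2 : (1 : ℝ) ≤ M := by linarith
    have h3 : 1 ≤ M := by exact_mod_cast h2
    omega
  push_cast at hMv
  have hmv : Real.sqrt v / 4 ≤ m := by linarith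
  have hmpos : (0 : ℝ) < m := by linarith
  have hmA : (m : ℝ) ≤ h * Real.sqrt n := by
    have : ((m + 1 : ℕ) : ℝ) ≤ A := by exact_mod_cast hMA
    push_cast at this
    linarith
  have hss : Real.sqrt n * Real.sqrt n = n := Real.mul_self_sqrt hnpos.le
  have hsn : 0 < Real.sqrt n := Real.sqrt_pos.2 hnpos
  -- Here the threshold `8` is used: `log(√v / 4) ≥ log v / 4` as soon as `log v ≥ 8 log 2`.
  have hlogm : Real.log v / 4 ≤ Real.log m := by
    have h2 := Real.log_le_log (by positivity) hmv
    rw [Real.log_div (by positivity) (by norm_num), Real.log_sqrt hvpos.le,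
      show (4 : ℝ) = 2 ^ 2 by norm_num, Real.log_pow] at h2
    have := Real.log_two_lt_d9
    push_cast at h2
    linarith
  have hmn : Real.sqrt n / h ≤ n / m := by
    rw [div_le_div_iff₀ h0 hmpos]
    calc Real.sqrt n * m ≤ Real.sqrt n * (h * Real.sqrt n) := by gcongr
      _ = n * h := by rw [mul_left_comm, hss, mul_comm]
  have hlogn : Real.log v ≤ 2 * Real.sqrt n := by
    have h2 : v ≤ n := hvn.trans (mul_le_of_le_one_right hnpos.le (pow_le_one₀ h0.le h1))
    have h3 := Real.log_le_log hvpos h2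
    have h4 := Real.log_le_sub_one_of_pos hsn
    rw [Real.log_sqrt hnpos.le] at h4
    linarith
  have hsn1 : 1 ≤ Real.sqrt n / h := by
    rw [one_le_div h0]
    have : h * Real.sqrt n ≤ 1 * Real.sqrt n := by gcongr
    linarith
  have hmin : min (n / m) ⌊Real.log m / h⌋₊ ≤ Γ := by
    refine log_le_localFixedPoint_of_hasStar h0 h1 hMstar (Nat.mul_div_le n m) (min_le_left _ _) ?_
    have hlog0 : 0 ≤ Real.log m := by linarith
    calc h * ((min (n / m) ⌊Real.log m / h⌋₊ : ℕ) : ℝ) ≤ h * (Real.log m / h) := by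
          gcongr
          refine le_trans ?_ (Nat.floor_le (by positivity))
          exact_mod_cast min_le_right _ _
      _ = Real.log m := by field_simp
  have hΓ0 : (0 : ℝ) ≤ Γ := Nat.cast_nonneg Γ
  rw [hLv] at hL ⊢
  rcases min_le_iff.1 hmin with hle | hle
  · have h2 : ((n / m : ℕ) : ℝ) ≤ Γ := by exact_mod_cast hle
    have h3 := half_le_floor (y := (n : ℝ) / m) (hsn1.trans hmn)
    rw [Nat.floor_div_eq_div] at h3
    have h4 : Real.log v / h ≤ 2 * (Real.sqrt n / h) := by
      rw [← mul_div_assoc]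
      gcongr
    linarith
  · have h2 := le_three_mul_of_floor_le hone hle
    have h3 : Real.log v / 4 / h ≤ Real.log m / h := by gcongr
    have h4 : Real.log v / 4 / h = Real.log v / h / 4 := by ring
    linarith

end

/-! ### Combination of the bounds -/

theorem proposition5p2 :
    ∃ c C : ℝ, 0 < c ∧ 0 < C ∧
      ∀ (X : Type*) (F : Set (X → Bool)) (d : ℕ), vcDim F = d → 1 ≤ d →
        ∀ (n : ℕ) (h : ℝ), 0 < h → h ≤ 1 →
          (d ≤ n →
            c * min ((d + truncLog (minExt (n * h ^ 2) (starNumber F))) / h) (Real.sqrt (d * n))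
              ≤ localFixedPoint F h h n) ∧
          (localFixedPoint F h h n : ℝ) ≤
            C * (d * truncLog (minExt (n * h ^ 2 / d) (starNumber F)) / h
              + d * truncLog (1 / h) / h) := by
  -- `160 = 144 + 16` adds the constants of the shattered-set and star bounds.
  refine ⟨1 / 160, 10, by norm_num, by norm_num, fun X F d hd hd1 n h h0 h1 => ⟨fun hdn => ?_,
    localFixedPoint_le hd hd1 n h0⟩⟩
  have hvc := vcDim_le_localFixedPoint hd hd1 hdn h0 h1
  have hst := truncLog_le_localFixedPoint F h0 h1 n
  have hpos : 0 ≤ truncLog (minExt (n * h ^ 2) (starNumber F)) / h :=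
    div_nonneg (zero_le_one.trans (one_le_truncLog _)) h0.le
  have hsum : min ((d + truncLog (minExt (n * h ^ 2) (starNumber F))) / h) (Real.sqrt (d * n)) ≤
      min (d / h) (Real.sqrt (d * n)) +
        truncLog (minExt (n * h ^ 2) (starNumber F)) / h := by
    rw [add_div, ← min_add_add_right]
    exact min_le_min le_rfl (by linarith)
  linarith
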